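/- A permutation is a bijection $w$ of $\{1,2,3,\dots\}$ that fixes all but finitely many integers, written in one-line notation $w_1w_2w_3\cdots$; its length is its number of inversions. Let $s_i$ be the transposition of $i$ and $i+1$. A reduced word of $w$ is a word $\rho=(\rho_1,\dots,\rho_p)$ of positive integers with $w=s_{\rho_1}s_{\rho_2}\cdots s_{\rho_p}$ (composition of functions) and $p$ equal to the length of $w$. A sequence of positive integers $\alpha_1\le\dots\le\alpha_p$ is $\rho$-compatible if $\alpha_j\le\rho_j$ for all $j$ and $\alpha_j<\alpha_{j+1}$ whenever $\rho_j<\rho_{j+1}$. The Schubert polynomial of $w$ is $$\mathfrak S_w=\sum_{\rho}\ \sum_{\alpha}x_{\alpha_1}\cdots x_{\alpha_p},$$ where $\rho$ runs over the reduced words of $w$ and $\alpha$ over the $\rho$-compatible sequences. For a polynomial $f$, write $f(x_1,\dots,x_k)$ for the result of setting $x_i=0$ in $f$ for all $i>k$. Let $k\ge 0$ be an integer and let $\lambda=(\lambda_1\ge\lambda_2\ge\cdots)$ be a partition with at most $k$ nonzero parts. The Schur polynomial $s_\lambda(x_1,\dots,x_k)$ is the sum of $\prod_{c\in\lambda}x_{T(c)}$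 over all semistandard Young tableaux $T$ of shape $\lambda$ with entries in $\{1,\dots,k\}$. The Grassmannian permutation $v=v(\lambda,k)$ is the permutation with $v_i=i+\lambda_{k-i+1}$ for $1\le i\le k$ and $v_{k+1}<v_{k+2}<\cdots$. Let $u$ be a permutation with no descent after position $k$, that is, $u_i<u_{i+1}$ for all $i>k$. Let $\ell\ge k$ be an integer such that $u_i=i$ for all $i>\ell$, and let $u\times_\ell v$ be the permutation with $(u\times_\ell v)_i=u_i$ for $i\le\ell$ and $(u\times_\ell v)_i=\ell+v_{i-\ell}$ for $i>\ell$. Then $$\mathfrak S_u\,\mathfrak S_v=\mathfrak S_u\,s_\lambda(x_1,\dots,x_k)=\mathfrak S_{u\times_\ell v}(x_1,\dots,x_k).$$ -/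

import Mathlib

open MvPolynomial

/-!
Positions, values, indices of simple transpositions and indices of variables are all numbered from
`0`: the position `i` below is the position `i + 1` of the usual one-line notation, `X i` is the
variable `x_{i+1}`, and the letter `i` in a word stands for the transposition of `i` and `i + 1`.
A permutation `w` is a bijection of `ℕ` and its one-line notation is `w 0, w 1, w 2, …`.
-/

/-- The inversions of `w`: pairs of positions `x < y` with `w y < w x`. -/
def inversions (w : Equiv.Perm ℕ) : Set (ℕ × ℕ) :=
  {p | p.1 < p.2 ∧ w p.2 < w p.1}

/-- The product `s_{ρ₁} s_{ρ₂} ⋯ s_{ρ_p}` of simple transpositions, composed as functions, so that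
reading `ρ` from left to right the letter `i` swaps the entries in positions `i` and `i + 1` of the
one-line notation obtained so far. -/
def wordProd (ρ : List ℕ) : Equiv.Perm ℕ :=
  (ρ.map fun i => Equiv.swap i (i + 1)).prod

/-- `ρ` is a reduced word of `w`: its product is `w` and its number of letters is the length
(the number of inversions) of `w`. -/
def IsReducedWord (w : Equiv.Perm ℕ) (ρ : List ℕ) : Prop :=
  wordProd ρ = w ∧ (inversions w).ncard = ρ.length

/-- `α` is `ρ`-compatible: it has as many entries as `ρ`, `α_j ≤ ρ_j` for all `j`, it is weakly
increasing, and `α_j < α_{j+1}` whenever `ρ_j < ρ_{j+1}`. -/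
def IsCompatible (ρ α : List ℕ) : Prop :=
  List.Forall₂ (fun a r => a ≤ r) α ρ ∧
    (α.zip ρ).IsChain fun p q => p.1 ≤ q.1 ∧ (p.2 < q.2 → p.1 < q.1)

/-- All pairs `(ρ, α)` of a reduced word `ρ` of `w` and a `ρ`-compatible sequence `α`. -/
def compatiblePairs (w : Equiv.Perm ℕ) : Set (List ℕ × List ℕ) :=
  {p | IsReducedWord w p.1 ∧ IsCompatible p.1 p.2}

theorem inversions_cons_subset (i : ℕ) (w : Equiv.Perm ℕ) :
    inversions (Equiv.swap i (i + 1) * w) ⊆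
      insert (w.symm i, w.symm (i + 1)) (inversions w) := by
  rintro ⟨x, y⟩ ⟨h1, h2⟩
  simp only [Equiv.Perm.mul_apply] at h1 h2
  simp only [Set.mem_insert_iff, Prod.mk.injEq, Equiv.eq_symm_apply, inversions, Set.mem_ofPred_eq]
  have hne : w x ≠ w y := fun h => by have := w.injective h; omega
  by_cases h : w y < w x
  · exact Or.inr ⟨h1, h⟩
  · left
    rw [Equiv.swap_apply_def, Equiv.swap_apply_def] at h2
    split_ifs at h2 <;> omega

theorem inversions_wordProd (ρ : List ℕ) :
    (inversions (wordProd ρ)).Finite ∧ (inversions (wordProd ρ)).ncard ≤ ρ.length := by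
  induction ρ with
  | nil =>
    have : inversions (wordProd []) = ∅ := by
      ext ⟨x, y⟩
      simp [inversions, wordProd]
      omega
    simp [this]
  | cons i ρ ih =>
    have h := inversions_cons_subset i (wordProd ρ)
    have e : Equiv.swap i (i + 1) * wordProd ρ = wordProd (i :: ρ) := by simp [wordProd]
    rw [e] at h
    have hf := ih.1.insert ((wordProd ρ).symm i, (wordProd ρ).symm (i + 1))
    refine ⟨hf.subset h, (Set.ncard_le_ncard h hf).trans ?_⟩
    exact (Set.ncard_insert_le _ _).trans (by simpa using ih.2)

theorem wordProd_apply_le {ρ : List ℕ} {i : ℕ} (hi : i ∉ ρ) (x : ℕ) :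
    wordProd ρ x ≤ i ↔ x ≤ i := by
  induction ρ with
  | nil => simp [wordProd]
  | cons j ρ ih =>
    simp only [List.mem_cons, not_or] at hi
    have e : wordProd (j :: ρ) x = Equiv.swap j (j + 1) (wordProd ρ x) := by simp [wordProd]
    rw [e, ← ih hi.2, Equiv.swap_apply_def]
    split_ifs <;> omega

theorem exists_inversion_of_mem {ρ : List ℕ} (h : IsReducedWord (wordProd ρ) ρ) {m : ℕ}
    (hm : m ∈ ρ) : ∃ x y, (x, y) ∈ inversions (wordProd ρ) ∧ x ≤ m ∧ m < y := by
  induction ρ with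
  | nil => simp at hm
  | cons i ρ ih =>
    have hs := inversions_cons_subset i (wordProd ρ)
    have e : Equiv.swap i (i + 1) * wordProd ρ = wordProd (i :: ρ) := by simp [wordProd]
    rw [e] at hs
    have hρ := inversions_wordProd ρ
    have hf := hρ.1.insert ((wordProd ρ).symm i, (wordProd ρ).symm (i + 1))
    have hle := Set.ncard_insert_le ((wordProd ρ).symm i, (wordProd ρ).symm (i + 1))
      (inversions (wordProd ρ))
    have hc := h.2
    have hc' := Set.ncard_le_ncard hs hf
    simp only [List.length_cons] at hc
    have heq := Set.eq_of_subset_of_ncard_le hs (by omega) hf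
    by_cases hmρ : m ∈ ρ
    · obtain ⟨x, y, hxy, h1⟩ := ih ⟨rfl, by omega⟩ hmρ
      exact ⟨x, y, heq ▸ Set.mem_insert_of_mem _ hxy, h1⟩
    · obtain rfl : m = i := by simpa [hmρ] using hm
      refine ⟨_, _, heq ▸ Set.mem_insert _ _, ?_, ?_⟩
      · rw [← wordProd_apply_le hmρ]; simp
      · rw [← not_le, ← wordProd_apply_le hmρ]; simp

theorem wordProd_apply_of_lt {ρ : List ℕ} {N : ℕ} (h : ∀ i ∈ ρ, i < N) {x : ℕ} (hx : N < x) :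
    wordProd ρ x = x := by
  induction ρ with
  | nil => simp [wordProd]
  | cons j ρ ih =>
    have e : wordProd (j :: ρ) x = Equiv.swap j (j + 1) (wordProd ρ x) := by simp [wordProd]
    have := h j (by simp)
    rw [e, ih fun i hi => h i (by simp [hi])]
    exact Equiv.swap_apply_of_ne_of_ne (by omega) (by omega)

theorem letter_lt {w : Equiv.Perm ℕ} {N : ℕ} (hN : ∀ x, N < x → w x = x) {ρ : List ℕ}
    (h : IsReducedWord w ρ) {m : ℕ} (hm : m ∈ ρ) : m < N := by
  obtain ⟨rfl, h2⟩ := h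
  obtain ⟨x, y, ⟨-, hxy⟩, h3, h4⟩ := exists_inversion_of_mem ⟨rfl, h2⟩ hm
  by_contra hlt
  simp only at hxy
  rw [hN y (by omega)] at hxy
  have := (wordProd ρ).injective (hN (wordProd ρ x) (by omega))
  omega

theorem finite_bounded_lists (N n : ℕ) :
    {l : List ℕ | l.length = n ∧ ∀ i ∈ l, i < N}.Finite := by
  refine ((List.finite_length_eq (Fin N) n).image (List.map Fin.val)).subset ?_
  rintro l ⟨h1, h2⟩
  refine ⟨l.pmap Fin.mk h2, by simpa using h1, ?_⟩
  simp [List.map_pmap]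

theorem compatiblePairs_finite (w : Equiv.Perm ℕ) : (compatiblePairs w).Finite := by
  rcases (compatiblePairs w).eq_empty_or_nonempty with h | ⟨⟨ρ₀, α₀⟩, h₀⟩
  · simp [h]
  have hN : ∀ x, ρ₀.sum + 1 < x → w x = x := fun x hx => by
    rw [← h₀.1.1]
    exact wordProd_apply_of_lt (fun i hi => Nat.lt_succ_of_le (List.le_sum_of_mem hi)) hx
  have hfin := finite_bounded_lists (ρ₀.sum + 1) (inversions w).ncard
  refine (hfin.prod hfin).subset ?_
  rintro ⟨ρ, α⟩ ⟨h1, h2, -⟩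
  have hlt : ∀ i ∈ ρ, i < ρ₀.sum + 1 := fun i hi => letter_lt hN h1 hi
  refine ⟨⟨h1.2.symm, hlt⟩, h2.length_eq.trans h1.2.symm, fun a ha => ?_⟩
  obtain ⟨j, hj, rfl⟩ := List.getElem_of_mem ha
  have hj' : j < ρ.length := h2.length_eq ▸ hj
  exact (List.Forall₂.get h2 hj hj').trans_lt (hlt _ (List.getElem_mem hj'))

/-- The Schubert polynomial of `w`: the sum over all reduced words `ρ` of `w` and all
`ρ`-compatible sequences `α` of the monomial `x_{α₁} x_{α₂} ⋯ x_{α_p}`. -/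
noncomputable def schubert (w : Equiv.Perm ℕ) : MvPolynomial ℕ ℤ :=
  ∑ p ∈ (compatiblePairs_finite w).toFinset, (p.2.map fun i => (X i : MvPolynomial ℕ ℤ)).prod

/-- The truncation `f(x_1, …, x_k)` of `f`: all variables other than the first `k` are set
to `0`. -/
noncomputable def truncate (k : ℕ) : MvPolynomial ℕ ℤ →ₐ[ℤ] MvPolynomial ℕ ℤ :=
  aeval fun i => if i < k then X i else 0

/-- For `u` fixing every position from `m` on, the permutation whose one-line notation consists of
the first `m` entries of `u` followed by the entries of `v`, each increased by `m`. -/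
def crossPerm (m : ℕ) (u v : Equiv.Perm ℕ) (hu : ∀ i, m ≤ i → u i = i) : Equiv.Perm ℕ where
  toFun i := if i < m then u i else m + v (i - m)
  invFun i := if i < m then u.symm i else m + v.symm (i - m)
  left_inv i := by
    by_cases h : i < m
    · have : u i < m := by
        by_contra h'
        have := u.injective (hu (u i) (by omega))
        omega
      simp [h, this]
    · simp [h]; omega
  right_inv i := by
    by_cases h : i < m
    · have : u.symm i < m := by
        by_contra h'
        have := hu (u.symm i) (by omega)
        simp at this
        omega
      simp [h, this]
    · simp [h]; omega

/-- The one-line notation of the grassmannian permutation of `lam` and `k`. With entries and parts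
numbered from `1`, its first `k` entries are `i + lam_{k-i+1}`. From position `k` on (numbered from
`0`) come the remaining values in increasing order; explicitly, position `k + j` holds `k + j`
minus the length of the `j`-th column of `lam`. -/
def grassmannianFun (lam : YoungDiagram) (k i : ℕ) : ℕ :=
  if i < k then i + lam.rowLen (k - 1 - i) else i - lam.colLen (i - k)

theorem grassmannianFun_lt (lam : YoungDiagram) {k : ℕ} (h : lam.colLen 0 ≤ k) {i j : ℕ}
    (hij : i < j) (hk : j < k ∨ k ≤ i) : grassmannianFun lam k i < grassmannianFun lam k j := by
  unfold grassmannianFun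
  rcases hk with hk | hk
  · have := lam.rowLen_anti (k - 1 - j) (k - 1 - i) (by omega)
    rw [if_pos (by omega), if_pos hk]
    omega
  · have h1 := lam.colLen_anti (i - k) (j - k) (by omega)
    have h2 := lam.colLen_anti 0 (i - k) (by omega)
    rw [if_neg (by omega), if_neg (by omega)]
    omega

theorem grassmannianFun_bijective (lam : YoungDiagram) (k : ℕ) (h : lam.colLen 0 ≤ k) :
    Function.Bijective (grassmannianFun lam k) := by
  have hne : ∀ i j, i < k → k ≤ j → grassmannianFun lam k i ≠ grassmannianFun lam k j := by
    intro i j hi hj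
    have h1 := lam.colLen_anti 0 (j - k) (by omega)
    have h2 := YoungDiagram.mem_iff_lt_rowLen (μ := lam) (i := k - 1 - i) (j := j - k)
    have h3 := YoungDiagram.mem_iff_lt_colLen (μ := lam) (i := k - 1 - i) (j := j - k)
    have h4 := h2.symm.trans h3
    unfold grassmannianFun
    rw [if_pos hi, if_neg (by omega)]
    omega
  have hlt : ∀ i j, i < j → grassmannianFun lam k i ≠ grassmannianFun lam k j := by
    intro i j hij
    by_cases hj : j < k
    · exact (grassmannianFun_lt lam h hij (Or.inl hj)).ne
    · by_cases hi : k ≤ i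
      · exact (grassmannianFun_lt lam h hij (Or.inr hi)).ne
      · exact hne i j (by omega) (by omega)
  have hinj : Function.Injective (grassmannianFun lam k) := by
    intro i j hij
    rcases lt_trichotomy i j with h' | h' | h'
    · exact absurd hij (hlt i j h')
    · exact h'
    · exact absurd hij.symm (hlt j i h')
  refine ⟨hinj, fun y => ?_⟩
  by_cases hy : k + lam.rowLen 0 ≤ y
  · refine ⟨y, ?_⟩
    have : lam.colLen (y - k) = 0 := by
      by_contra h0
      have h1 := YoungDiagram.mem_iff_lt_colLen.2 (Nat.pos_of_ne_zero h0)
      have := YoungDiagram.mem_iff_lt_rowLen.1 h1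
      omega
    simp only [grassmannianFun, this]
    rw [if_neg (by omega), Nat.sub_zero]
  · have hmaps : Set.MapsTo (grassmannianFun lam k) (Set.Iio (k + lam.rowLen 0))
        (Set.Iio (k + lam.rowLen 0)) := by
      intro i hi
      have := lam.rowLen_anti 0 (k - 1 - i) (by omega)
      simp only [Set.mem_Iio] at hi ⊢
      unfold grassmannianFun
      split_ifs <;> omega
    have himg : grassmannianFun lam k '' Set.Iio (k + lam.rowLen 0) = Set.Iio (k + lam.rowLen 0) :=
      Set.eq_of_subset_of_ncard_le hmaps.image_subset
        (Set.ncard_image_of_injective _ hinj).ge (Set.finite_Iio _)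
    obtain ⟨x, -, hx⟩ := himg.symm.subset (Set.mem_Iio.2 (not_le.1 hy))
    exact ⟨x, hx⟩

/-- The grassmannian permutation `v(lam, k)` of a partition `lam` with at most `k` parts. -/
noncomputable def grassmannianPerm (lam : YoungDiagram) (k : ℕ) (h : lam.colLen 0 ≤ k) :
    Equiv.Perm ℕ :=
  Equiv.ofBijective (grassmannianFun lam k) (grassmannianFun_bijective lam k h)

/-- The semistandard Young tableaux of shape `lam` with entries among the first `k` indices
`0, …, k - 1`. -/
def boundedTableaux (lam : YoungDiagram) (k : ℕ) : Set (SemistandardYoungTableau lam) :=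
  {T | ∀ c ∈ lam.cells, T c.1 c.2 < k}

theorem boundedTableaux_finite (lam : YoungDiagram) (k : ℕ) : (boundedTableaux lam k).Finite := by
  refine Set.Finite.of_injOn (f := fun T (c : lam.cells) => T c.1.1 c.1.2)
    (t := Set.pi Set.univ fun _ => Set.Iio k) (fun T hT c _ => hT c.1 c.2) ?_
    (Set.Finite.pi fun _ => Set.finite_Iio k)
  intro T _ T' _ h
  ext i j
  by_cases hc : (i, j) ∈ lam
  · exact congrFun h ⟨(i, j), hc⟩
  · rw [T.zeros hc, T'.zeros hc]

/-- The Schur polynomial `s_lam(x_1, …, x_k)`: the sum over all semistandard Young tableaux of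
shape `lam` with entries among the first `k` indices of the product of `x_{T(c)}` over the cells
`c`. -/
noncomputable def schurPoly (lam : YoungDiagram) (k : ℕ) : MvPolynomial ℕ ℤ :=
  ∑ T ∈ (boundedTableaux_finite lam k).toFinset, ∏ c ∈ lam.cells, X (T c.1 c.2)

/-! In the nilCoxeter algebra with generators u_m, the Schubert polynomial is the coefficient of w
in the product over i = 0, 1, … of (1 + x_i u_{M-1}) ⋯ (1 + x_i u_i), for M large (Fomin–Stanley).
`schubertFrom i m w` is the coefficient of w in the tail of this product that begins with the factor
1 + x_i u_{m-1}; peeling factors off the left gives a recursion through left descents, along which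
all facts about Schubert polynomials are proved.

Since u ×_l v = u · (1 ×_l v) and the two factors move disjoint ranges of values, each letter of the
recursion acts on only one of them, so the Schubert polynomial factors (`schubert_mul`). The factor
of u survives truncation to k variables because u has no descent after position k
(`truncate_schubert`). The permutation 1 ×_l v is grassmannian for the same partition and k + l, so
its Schubert polynomial is a Schur polynomial in k + l variables, which truncates to the one in k
variables.

It remains to identify grassmannian Schubert polynomials with Schur polynomials. Left descents of a
grassmannian permutation are corners of its partition, and the letters sharing one value i remove a
horizontal strip. Tableaux are also chains of horizontal strips, but their largest entry is removed
first, whereas the Schubert recursion removes x_0 first. The Bender–Knuth involution makes the sum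
over chains symmetric (`stripSum_perm`) and reconciles the two orders. -/

/-! ### Left descents and first letters of reduced words. -/

theorem wordProd_cons (m : ℕ) (ρ : List ℕ) :
    wordProd (m :: ρ) = Equiv.swap m (m + 1) * wordProd ρ := by
  simp [wordProd]

/-- `m` is a left descent of `w`: the value `m + 1` stands to the left of the value `m`. -/
def LeftDescent (w : Equiv.Perm ℕ) (m : ℕ) : Prop :=
  w.symm (m + 1) < w.symm m

theorem swap_mul_symm_apply (w : Equiv.Perm ℕ) (m x : ℕ) :
    (Equiv.swap m (m + 1) * w).symm x = w.symm (Equiv.swap m (m + 1) x) :=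
  rfl

theorem LeftDescent.not_swap_mul {w : Equiv.Perm ℕ} {m : ℕ} (h : LeftDescent w m) :
    ¬ LeftDescent (Equiv.swap m (m + 1) * w) m := by
  unfold LeftDescent at *
  simp only [swap_mul_symm_apply, Equiv.swap_apply_left, Equiv.swap_apply_right]
  omega

/-- Exchanging the values m and m + 1 affects the relative order of that pair only, and without a
left descent that pair is not an inversion. -/
theorem inversions_subset_swap_mul {w : Equiv.Perm ℕ} {m : ℕ} (h : ¬ LeftDescent w m) :
    inversions w ⊆ inversions (Equiv.swap m (m + 1) * w) := by
  rintro ⟨x, y⟩ ⟨h1, h2⟩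
  refine ⟨h1, ?_⟩
  simp only [LeftDescent, not_lt] at h
  simp only [Equiv.Perm.mul_apply] at h1 h2 ⊢
  by_cases hxy : w x = m + 1 ∧ w y = m
  · rw [← hxy.1, ← hxy.2] at h
    simp at h
    omega
  · rw [Equiv.swap_apply_def, Equiv.swap_apply_def]
    split_ifs <;> omega

/-- Left multiplication by the transposition changes the inversion set by at most one pair, gained
or lost according to the left descent. The word ρ supplies the finiteness needed to compare
cardinalities. -/
theorem isReducedWord_cons {w : Equiv.Perm ℕ} {m : ℕ} {ρ : List ℕ} :
    IsReducedWord w (m :: ρ) ↔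
      LeftDescent w m ∧ IsReducedWord (Equiv.swap m (m + 1) * w) ρ := by
  have hprod : wordProd (m :: ρ) = w ↔ wordProd ρ = Equiv.swap m (m + 1) * w := by
    rw [wordProd_cons]
    constructor <;> rintro h
    · rw [← h]; simp
    · rw [h]; simp
  unfold IsReducedWord
  rw [hprod]
  by_cases h : wordProd ρ = Equiv.swap m (m + 1) * w
  swap
  · simp [h]
  have hw : w = Equiv.swap m (m + 1) * (Equiv.swap m (m + 1) * w) := by simp
  have hfin' : (inversions (Equiv.swap m (m + 1) * w)).Finite := h ▸ (inversions_wordProd ρ).1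
  have hle' : (inversions (Equiv.swap m (m + 1) * w)).ncard ≤ ρ.length :=
    h ▸ (inversions_wordProd ρ).2
  have hsub := inversions_cons_subset m (Equiv.swap m (m + 1) * w)
  rw [← hw] at hsub
  have hins := hfin'.insert ((Equiv.swap m (m + 1) * w).symm m,
    (Equiv.swap m (m + 1) * w).symm (m + 1))
  have hle := (Set.ncard_le_ncard hsub hins).trans (Set.ncard_insert_le _ _)
  have hdesc (hd : LeftDescent w m) :
      (inversions (Equiv.swap m (m + 1) * w)).ncard < (inversions w).ncard := by
    refine Set.ncard_lt_ncard (ssubset_of_subset_of_ne ?_ ?_) (hins.subset hsub)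
    · conv_rhs => rw [hw]
      exact inversions_subset_swap_mul hd.not_swap_mul
    · intro he
      have hmem : (w.symm (m + 1), w.symm m) ∈ inversions w := ⟨hd, by simp⟩
      rw [← he] at hmem
      have := hmem.2
      simp at this
  have hnot (hd : ¬ LeftDescent w m) :=
    Set.ncard_le_ncard (inversions_subset_swap_mul hd) hfin'
  simp only [h, true_and, List.length_cons]
  by_cases hd : LeftDescent w m
  · have := hdesc hd
    simp only [hd, true_and]
    omega
  · have := hnot hd
    simp only [hd, false_and, iff_false]
    omega

theorem isReducedWord_nil {w : Equiv.Perm ℕ} : IsReducedWord w [] ↔ w = 1 := by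
  constructor
  · rintro ⟨h, -⟩
    rw [← h]
    simp [wordProd]
  · rintro rfl
    have h := (inversions_wordProd []).2
    refine ⟨by simp [wordProd], ?_⟩
    simpa [wordProd] using h

/-! ### The recursion for Schubert polynomials. -/

/-- The compatible pairs `(ρ, α)` of `w` such that all entries of `α` are at least `i`, and the
first letter of `ρ` is less than `m` if the first entry of `α` is `i`. -/
def pairsFrom (i m : ℕ) (w : Equiv.Perm ℕ) : Set (List ℕ × List ℕ) :=
  {p | p ∈ compatiblePairs w ∧
    ∀ q ∈ (p.2.zip p.1).head?, i ≤ q.1 ∧ (q.1 = i → q.2 < m)}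

theorem pairsFrom_finite (i m : ℕ) (w : Equiv.Perm ℕ) : (pairsFrom i m w).Finite :=
  (compatiblePairs_finite w).subset fun _ hp => hp.1

/-- The part of the Schubert polynomial of `w` that comes from `pairsFrom i m w`. -/
noncomputable def schubertFrom (i m : ℕ) (w : Equiv.Perm ℕ) : MvPolynomial ℕ ℤ :=
  ∑ p ∈ (pairsFrom_finite i m w).toFinset, (p.2.map fun i => (X i : MvPolynomial ℕ ℤ)).prod

theorem nil_nil_mem_compatiblePairs {w : Equiv.Perm ℕ} :
    ([], []) ∈ compatiblePairs w ↔ w = 1 := by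
  simp [compatiblePairs, IsCompatible, isReducedWord_nil]

theorem length_eq_of_mem_compatiblePairs {w : Equiv.Perm ℕ} {p : List ℕ × List ℕ}
    (h : p ∈ compatiblePairs w) : p.2.length = p.1.length :=
  h.2.1.length_eq

theorem cons_cons_mem_compatiblePairs_iff_succ {w : Equiv.Perm ℕ} {r a : ℕ} {ρ α : List ℕ} :
    (r :: ρ, a :: α) ∈ compatiblePairs w ↔
      LeftDescent w r ∧ a ≤ r ∧ (ρ, α) ∈ pairsFrom a (r + 1) (Equiv.swap r (r + 1) * w) := by
  simp only [compatiblePairs, pairsFrom, IsCompatible, Set.mem_ofPred_eq, isReducedWord_cons,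
    List.forall₂_cons, List.zip_cons_cons, List.isChain_cons]
  have : ∀ q : ℕ × ℕ, (a ≤ q.1 ∧ (r < q.2 → a < q.1)) ↔ (a ≤ q.1 ∧ (q.1 = a → q.2 < r + 1)) := by
    intro q
    omega
  simp only [this]
  tauto

/-- The only new first letter would be m, and a reduced word starts only with left descents. After a
letter r is removed this turns the weak decrease of letters sharing a value into a strict one. -/
theorem pairsFrom_succ_of_not_leftDescent {w : Equiv.Perm ℕ} {m : ℕ} (h : ¬ LeftDescent w m)
    (i : ℕ) : pairsFrom i (m + 1) w = pairsFrom i m w := by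
  ext ⟨ρ, α⟩
  refine and_congr_right fun hp => ?_
  rcases ρ with _ | ⟨r, ρ⟩ <;> rcases α with _ | ⟨a, α⟩ <;> try simp
  have := (cons_cons_mem_compatiblePairs_iff_succ.1 hp).1
  have : r ≠ m := by rintro rfl; exact h this
  omega

theorem cons_cons_mem_compatiblePairs {w : Equiv.Perm ℕ} {r a : ℕ} {ρ α : List ℕ} :
    (r :: ρ, a :: α) ∈ compatiblePairs w ↔
      LeftDescent w r ∧ a ≤ r ∧ (ρ, α) ∈ pairsFrom a r (Equiv.swap r (r + 1) * w) := by
  rw [cons_cons_mem_compatiblePairs_iff_succ]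
  refine and_congr_right fun h => ?_
  rw [pairsFrom_succ_of_not_leftDescent h.not_swap_mul]

theorem schubertFrom_succ_of_not_leftDescent {w : Equiv.Perm ℕ} {m : ℕ} (h : ¬ LeftDescent w m)
    (i : ℕ) : schubertFrom i (m + 1) w = schubertFrom i m w := by
  simp only [schubertFrom, pairsFrom_succ_of_not_leftDescent h]

/-- This peels off the factor 1 + x_i u_m: the new pairs start with the letter m carrying the value
i, and are counted by deleting that first entry. -/
theorem schubertFrom_succ_of_leftDescent {w : Equiv.Perm ℕ} {i m : ℕ} (h : LeftDescent w m)
    (him : i ≤ m) : schubertFrom i (m + 1) w =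
      schubertFrom i m w + X i * schubertFrom i m (Equiv.swap m (m + 1) * w) := by
  have hset : (pairsFrom_finite i (m + 1) w).toFinset = (pairsFrom_finite i m w).toFinset ∪
      (pairsFrom_finite i m (Equiv.swap m (m + 1) * w)).toFinset.image
        fun p => (m :: p.1, i :: p.2) := by
    ext ⟨ρ, α⟩
    simp only [Set.Finite.mem_toFinset, Finset.mem_union, Finset.mem_image, Prod.mk.injEq,
      Prod.exists]
    rcases ρ with _ | ⟨r, ρ⟩ <;> rcases α with _ | ⟨a, α⟩ <;>
      simp only [pairsFrom, Set.mem_ofPred_eq] <;> try simp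
    by_cases hra : r = m ∧ a = i
    · obtain ⟨rfl, rfl⟩ := hra
      simp [cons_cons_mem_compatiblePairs, h, him, pairsFrom]
    · have : ¬ (m = r ∧ i = a) := by omega
      simp only [this, and_false, or_false]
      refine and_congr_right fun _ => and_congr_right fun _ => ?_
      omega
  have hdisj : Disjoint (pairsFrom_finite i m w).toFinset
      ((pairsFrom_finite i m (Equiv.swap m (m + 1) * w)).toFinset.image
        fun p => (m :: p.1, i :: p.2)) := by
    rw [Finset.disjoint_right]
    intro p hp
    obtain ⟨q, -, rfl⟩ := Finset.mem_image.1 hp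
    simp [pairsFrom]
  rw [schubertFrom, hset, Finset.sum_union hdisj, Finset.sum_image, schubertFrom, schubertFrom,
    Finset.mul_sum]
  · simp
  · rintro ⟨_, _⟩ _ ⟨_, _⟩ _ h
    simpa using h

/-- A letter carrying the value i is at least i, so none is available below i and the next variable
takes over; letters below M are no restriction. -/
theorem schubertFrom_self {w : Equiv.Perm ℕ} {M : ℕ} (hM : ∀ x, M < x → w x = x) (i : ℕ) :
    schubertFrom i i w = schubertFrom (i + 1) M w := by
  have : pairsFrom i i w = pairsFrom (i + 1) M w := by
    ext ⟨ρ, α⟩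
    refine and_congr_right fun hp => ?_
    rcases ρ with _ | ⟨r, ρ⟩ <;> rcases α with _ | ⟨a, α⟩ <;> try simp
    have h1 := (cons_cons_mem_compatiblePairs.1 hp).2.1
    have h2 := letter_lt hM hp.1 (List.mem_cons_self ..)
    omega
  simp only [schubertFrom, this]

theorem schubert_eq_schubertFrom {w : Equiv.Perm ℕ} {M : ℕ} (hM : ∀ x, M < x → w x = x) :
    schubert w = schubertFrom 0 M w := by
  have : compatiblePairs w = pairsFrom 0 M w := by
    ext ⟨ρ, α⟩
    refine ⟨fun hp => ⟨hp, ?_⟩, fun hp => hp.1⟩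
    rcases ρ with _ | ⟨r, ρ⟩ <;> rcases α with _ | ⟨a, α⟩ <;> try simp
    intro
    exact letter_lt hM hp.1 (List.mem_cons_self ..)
  simp only [schubert, schubertFrom, this]

theorem schubertFrom_of_le {w : Equiv.Perm ℕ} {M : ℕ} (hM : ∀ x, M < x → w x = x) {i : ℕ}
    (hi : M ≤ i) (m : ℕ) [Decidable (w = 1)] : schubertFrom i m w = if w = 1 then 1 else 0 := by
  have hnil : ∀ p ∈ pairsFrom i m w, p = ([], []) := by
    rintro ⟨ρ, α⟩ ⟨hp, hq⟩
    have hl := length_eq_of_mem_compatiblePairs hp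
    rcases ρ with _ | ⟨r, ρ⟩ <;> rcases α with _ | ⟨a, α⟩ <;> try simp at hl
    · rfl
    have h1 := (cons_cons_mem_compatiblePairs.1 hp).2.1
    have h2 := letter_lt hM hp.1 (List.mem_cons_self ..)
    simp at hq
    omega
  split_ifs with h
  · have : (pairsFrom_finite i m w).toFinset = {([], [])} := by
      ext p
      simp only [Set.Finite.mem_toFinset, Finset.mem_singleton]
      refine ⟨hnil p, ?_⟩
      rintro rfl
      exact ⟨nil_nil_mem_compatiblePairs.2 h, by simp⟩
    simp [schubertFrom, this]
  · refine Finset.sum_eq_zero fun p hp => absurd ?_ h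
    rw [Set.Finite.mem_toFinset] at hp
    rw [hnil p hp] at hp
    exact nil_nil_mem_compatiblePairs.1 hp.1

/-- Induction along the recursion of `schubertFrom`. -/
theorem schubertFrom_induction {M : ℕ} {motive : ∀ i m, i ≤ m → m ≤ M → Prop}
    (last : motive M M le_rfl le_rfl)
    (self : ∀ i (hi : i < M), motive (i + 1) M hi le_rfl → motive i i le_rfl hi.le)
    (succ : ∀ i m (him : i ≤ m) (hm : m < M), motive i m him hm.le →
      motive i (m + 1) (him.trans m.le_succ) hm)
    {i m : ℕ} (him : i ≤ m) (hm : m ≤ M) : motive i m him hm := by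
  have key : ∀ i (hi : i ≤ M), motive i i le_rfl hi → ∀ m (him : i ≤ m) (hm : m ≤ M),
      motive i m him hm := by
    intro i _ h m him
    induction m, him using Nat.le_induction with
    | base => exact fun _ => h
    | succ m him ih => exact fun hm => succ i m him hm (ih (by omega))
  have diag : ∀ i (hi : i ≤ M), motive i M hi le_rfl := fun i hi => by
    induction hi using Nat.decreasingInduction with
    | self => exact last
    | of_succ i hi ih => exact key i hi.le (self i hi ih) M hi.le le_rfl
  rcases (him.trans hm).eq_or_lt with rfl | hi
  · obtain rfl : m = i := by omega
    exact last
  · exact key i hi.le (self i hi (diag _ hi)) m him hm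

/-! ### Factorization over disjoint supports. -/

theorem swap_mul_apply_of_lt {w : Equiv.Perm ℕ} {M m : ℕ} (hM : ∀ x, M < x → w x = x)
    (hm : m < M) (x : ℕ) (hx : M < x) : (Equiv.swap m (m + 1) * w) x = x := by
  rw [Equiv.Perm.mul_apply, hM x hx, Equiv.swap_apply_of_ne_of_ne (by omega) (by omega)]

theorem schubertFrom_one (i m : ℕ) : schubertFrom i m 1 = 1 := by
  classical
  rw [schubertFrom_of_le (M := 0) (by simp) (Nat.zero_le i), if_pos rfl]

/-- A letter m with m + 1 < l can be a descent of u only, a letter m ≥ l of v only, and m + 1 = l of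
neither. The recursions of the product and of the two factors therefore run in parallel. -/
theorem schubertFrom_mul {l M : ℕ} {i m : ℕ} (him : i ≤ m) (hm : m ≤ M) {u v : Equiv.Perm ℕ}
    (hu : ∀ x, l ≤ x → u x = x) (hv : ∀ x, x < l → v x = x)
    (huM : ∀ x, M < x → u x = x) (hvM : ∀ x, M < x → v x = x) :
    schubertFrom i m (u * v) = schubertFrom i m u * schubertFrom i m v := by
  have hmul {u v : Equiv.Perm ℕ} (huM : ∀ x, M < x → u x = x) (hvM : ∀ x, M < x → v x = x) (x : ℕ)
      (hx : M < x) : (u * v) x = x := by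
    rw [Equiv.Perm.mul_apply, hvM x hx, huM x hx]
  induction him, hm using schubertFrom_induction generalizing u v with
  | last =>
    classical
    rw [schubertFrom_of_le (hmul huM hvM) le_rfl, schubertFrom_of_le huM le_rfl,
      schubertFrom_of_le hvM le_rfl]
    by_cases h1 : v = 1
    · simp [h1]
    · rw [if_neg h1, mul_zero, if_neg]
      intro h
      refine h1 (Equiv.ext fun x => ?_)
      have hx := congrArg (fun w : Equiv.Perm ℕ => w x) h
      simp only [Equiv.Perm.mul_apply, Equiv.Perm.one_apply] at hx ⊢
      by_cases hxl : x < l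
      · exact hv x hxl
      · rwa [hu (v x) ?_] at hx
        by_contra hvx
        have := v.injective (hv (v x) (by omega))
        omega
  | self i _ ih =>
    rw [schubertFrom_self (hmul huM hvM), schubertFrom_self huM, schubertFrom_self hvM,
      ih hu hv huM hvM]
  | succ i m him hmM ih =>
    have hus : ∀ x, l ≤ x → u.symm x = x := fun x hx => by
      rw [Equiv.symm_apply_eq, hu x hx]
    have hvs : ∀ x, x < l → v.symm x = x := fun x hx => by
      rw [Equiv.symm_apply_eq, hv x hx]
    have husl : ∀ x, x < l → u.symm x < l := fun x hx => by
      by_contra h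
      have := hu (u.symm x) (by omega)
      simp at this
      omega
    have hvsl : ∀ x, l ≤ x → l ≤ v.symm x := fun x hx => by
      by_contra h
      have := hv (v.symm x) (by omega)
      simp at this
      omega
    have huvl : ∀ x, x < l → (u * v).symm x = u.symm x := fun x hx => hvs _ (husl x hx)
    have huvr : ∀ x, l ≤ x → (u * v).symm x = v.symm x := fun x hx => by
      change v.symm (u.symm x) = _
      rw [hus x hx]
    rcases lt_trichotomy (m + 1) l with hml | hml | hml
    · have hdv : ¬ LeftDescent v m := by
        rw [LeftDescent, hvs m (by omega), hvs (m + 1) hml]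
        omega
      have hd : LeftDescent (u * v) m ↔ LeftDescent u m := by
        rw [LeftDescent, LeftDescent, huvl m (by omega), huvl (m + 1) hml]
      rw [schubertFrom_succ_of_not_leftDescent hdv]
      by_cases hdu : LeftDescent u m
      · rw [schubertFrom_succ_of_leftDescent hdu him,
          schubertFrom_succ_of_leftDescent (hd.2 hdu) him, ih hu hv huM hvM, ← mul_assoc,
          ih _ hv (swap_mul_apply_of_lt huM hmM) hvM]
        · ring
        · intro x hx
          rw [Equiv.Perm.mul_apply, hu x hx,
            Equiv.swap_apply_of_ne_of_ne (by omega) (by omega)]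
      · rw [schubertFrom_succ_of_not_leftDescent hdu,
          schubertFrom_succ_of_not_leftDescent (fun h => hdu (hd.1 h)), ih hu hv huM hvM]
    · have hdv : ¬ LeftDescent v m := by
        have := hvsl (m + 1) hml.ge
        rw [LeftDescent, hvs m (by omega)]
        omega
      have hdu : ¬ LeftDescent u m := by
        have := husl m (by omega)
        rw [LeftDescent, hus (m + 1) hml.ge]
        omega
      have hd : ¬ LeftDescent (u * v) m := by
        have := husl m (by omega)
        have := hvsl (m + 1) hml.ge
        rw [LeftDescent, huvl m (by omega), huvr (m + 1) hml.ge]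
        omega
      rw [schubertFrom_succ_of_not_leftDescent hdv, schubertFrom_succ_of_not_leftDescent hdu,
        schubertFrom_succ_of_not_leftDescent hd, ih hu hv huM hvM]
    · have hdu : ¬ LeftDescent u m := by
        rw [LeftDescent, hus m (by omega), hus (m + 1) hml.le]
        omega
      have hd : LeftDescent (u * v) m ↔ LeftDescent v m := by
        rw [LeftDescent, LeftDescent, huvr m (by omega), huvr (m + 1) hml.le]
      rw [schubertFrom_succ_of_not_leftDescent hdu]
      by_cases hdv : LeftDescent v m
      -- The transposition commutes with u because u fixes both m and m + 1.
      · have hcomm : Equiv.swap m (m + 1) * (u * v) = u * (Equiv.swap m (m + 1) * v) := by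
          rw [← mul_assoc, ← mul_assoc, Equiv.mul_swap_eq_swap_mul, hu m (by omega),
            hu (m + 1) hml.le]
        rw [schubertFrom_succ_of_leftDescent hdv him,
          schubertFrom_succ_of_leftDescent (hd.2 hdv) him, ih hu hv huM hvM, hcomm,
          ih hu _ huM (swap_mul_apply_of_lt hvM hmM)]
        · ring
        · intro x hx
          rw [Equiv.Perm.mul_apply, hv x hx,
            Equiv.swap_apply_of_ne_of_ne (by omega) (by omega)]
      · rw [schubertFrom_succ_of_not_leftDescent hdv,
          schubertFrom_succ_of_not_leftDescent (fun h => hdv (hd.1 h)), ih hu hv huM hvM]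

theorem schubert_mul {l M : ℕ} {u v : Equiv.Perm ℕ}
    (hu : ∀ x, l ≤ x → u x = x) (hv : ∀ x, x < l → v x = x)
    (huM : ∀ x, M < x → u x = x) (hvM : ∀ x, M < x → v x = x) :
    schubert (u * v) = schubert u * schubert v := by
  rw [schubert_eq_schubertFrom huM, schubert_eq_schubertFrom hvM,
    schubert_eq_schubertFrom (M := M), schubertFrom_mul (Nat.zero_le M) le_rfl hu hv huM hvM]
  intro x hx
  rw [Equiv.Perm.mul_apply, hvM x hx, huM x hx]

/-! ### Truncation and descents. -/

/-- If `m` is a left descent of `w`, exchanging the values `m` and `m + 1` keeps `w` increasing on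
every set of positions where it is increasing. -/
theorem StrictMonoOn.swap_mul {w : Equiv.Perm ℕ} {m : ℕ} (h : LeftDescent w m) {s : Set ℕ}
    (hw : StrictMonoOn w s) : StrictMonoOn (Equiv.swap m (m + 1) * w : Equiv.Perm ℕ) s := by
  intro x hx y hy hxy
  have hlt := hw hx hy hxy
  have hne : ¬ (w x = m ∧ w y = m + 1) := by
    rintro ⟨rfl, h2⟩
    rw [LeftDescent, ← h2] at h
    simp at h
    omega
  rw [Equiv.Perm.mul_apply, Equiv.Perm.mul_apply, Equiv.swap_apply_def, Equiv.swap_apply_def]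
  split_ifs <;> omega

/-- Values at least k force letters at least k. A product of such letters fixes the first k
positions, so if it is also increasing from position k on, it is the identity. -/
theorem schubertFrom_eq_zero {k M i m : ℕ} (him : i ≤ m) (hm : m ≤ M) (hki : k ≤ i)
    {w : Equiv.Perm ℕ} (hw : StrictMonoOn w (Set.Ici k)) (hM : ∀ x, M < x → w x = x)
    (h1 : w ≠ 1) : schubertFrom i m w = 0 := by
  induction him, hm using schubertFrom_induction generalizing w with
  | last =>
    classical
    rw [schubertFrom_of_le hM le_rfl, if_neg h1]
  | self i _ ih => rw [schubertFrom_self hM, ih (by omega) hw hM h1]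
  | succ i m him hmM ih =>
    by_cases hd : LeftDescent w m
    · rw [schubertFrom_succ_of_leftDescent hd him, ih hki hw hM h1,
        ih hki (hw.swap_mul hd) (swap_mul_apply_of_lt hM hmM), mul_zero, add_zero]
      -- Otherwise w is the transposition itself, which has a descent at position m ≥ k.
      intro h
      have hws : w = Equiv.swap m (m + 1) := by
        rw [← mul_right_inj (Equiv.swap m (m + 1)), h, Equiv.swap_mul_self]
      have := hw (show k ≤ m by omega) (show k ≤ m + 1 by omega) (Nat.lt_succ_self m)
      rw [hws] at this
      simp at this
    · rw [schubertFrom_succ_of_not_leftDescent hd, ih hki hw hM h1]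

theorem truncate_schubertFrom {k M i m : ℕ} (him : i ≤ m) (hm : m ≤ M)
    {w : Equiv.Perm ℕ} (hw : StrictMonoOn w (Set.Ici k)) (hM : ∀ x, M < x → w x = x) :
    truncate k (schubertFrom i m w) = schubertFrom i m w := by
  by_cases hki : k ≤ i
  · by_cases h1 : w = 1
    · rw [h1, schubertFrom_one, map_one]
    · rw [schubertFrom_eq_zero him hm hki hw hM h1, map_zero]
  rw [not_le] at hki
  induction him, hm using schubertFrom_induction generalizing w with
  | last =>
    classical
    rw [schubertFrom_of_le hM le_rfl]
    split_ifs <;> simp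
  | self i hi ih =>
    rw [schubertFrom_self hM]
    rcases Nat.lt_or_ge (i + 1) k with h | h
    · exact ih hw hM h
    · by_cases h1 : w = 1
      · rw [h1, schubertFrom_one, map_one]
      · rw [schubertFrom_eq_zero hi le_rfl h hw hM h1, map_zero]
  | succ i m him hmM ih =>
    by_cases hd : LeftDescent w m
    · rw [schubertFrom_succ_of_leftDescent hd him, map_add, map_mul, ih hw hM hki,
        ih (hw.swap_mul hd) (swap_mul_apply_of_lt hM hmM) hki, truncate, aeval_X, if_pos hki]
    · rw [schubertFrom_succ_of_not_leftDescent hd, ih hw hM hki]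

/-- The Schubert polynomial of a permutation without descents after position `k` involves only the
first `k` variables. -/
theorem truncate_schubert {k M : ℕ} {w : Equiv.Perm ℕ} (hw : StrictMonoOn w (Set.Ici k))
    (hM : ∀ x, M < x → w x = x) : truncate k (schubert w) = schubert w := by
  rw [schubert_eq_schubertFrom hM, truncate_schubertFrom (Nat.zero_le M) le_rfl hw hM]

/-! ### Chains of horizontal strips and their symmetry. -/

/-- The sequence `f 1, f 2, …`. -/
noncomputable def Finsupp.dropHead (f : ℕ →₀ ℕ) : ℕ →₀ ℕ :=
  f.comapDomain Nat.succ Nat.succ_injective.injOn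

/-- The sequence `a, f 0, f 1, …`. -/
noncomputable def Finsupp.addHead (a : ℕ) (f : ℕ →₀ ℕ) : ℕ →₀ ℕ :=
  Finsupp.single 0 a + f.mapDomain Nat.succ

@[simp]
theorem Finsupp.dropHead_apply (f : ℕ →₀ ℕ) (r : ℕ) : f.dropHead r = f (r + 1) :=
  rfl

@[simp]
theorem Finsupp.addHead_zero (a : ℕ) (f : ℕ →₀ ℕ) : Finsupp.addHead a f 0 = a := by
  rw [Finsupp.addHead, Finsupp.add_apply, Finsupp.mapDomain_of_notMem_range]
  · simp
  · simp

@[simp]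
theorem Finsupp.addHead_succ (a : ℕ) (f : ℕ →₀ ℕ) (r : ℕ) :
    Finsupp.addHead a f (r + 1) = f r := by
  rw [Finsupp.addHead, Finsupp.add_apply, ← Nat.succ_eq_add_one,
    Finsupp.mapDomain_apply Nat.succ_injective]
  simp

theorem Finsupp.addHead_dropHead (f : ℕ →₀ ℕ) : Finsupp.addHead (f 0) f.dropHead = f := by
  ext r
  cases r <;> simp

theorem Finsupp.degree_addHead (a : ℕ) (f : ℕ →₀ ℕ) :
    (Finsupp.addHead a f).degree = a + f.degree := by
  rw [Finsupp.addHead, map_add, Finsupp.degree_single, Finsupp.degree_mapDomain]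

theorem Finsupp.degree_sup_add_degree_inf (f g : ℕ →₀ ℕ) :
    (f ⊔ g).degree + (f ⊓ g).degree = f.degree + g.degree := by
  rw [← map_add, ← map_add]
  congr 1
  ext r
  exact max_add_min (f r) (g r)

/-- The sequences `g` such that `f / g` is a horizontal strip, for `f` the sequence of parts of a
partition. -/
noncomputable def strips (f : ℕ →₀ ℕ) : Finset (ℕ →₀ ℕ) :=
  Finset.Icc f.dropHead f

theorem mem_strips {f g : ℕ →₀ ℕ} : g ∈ strips f ↔ ∀ r, f (r + 1) ≤ g r ∧ g r ≤ f r := by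
  rw [strips, Finset.mem_Icc, Finsupp.le_def, Finsupp.le_def, ← forall_and]
  rfl

theorem degree_le_of_mem_strips {f g : ℕ →₀ ℕ} (h : g ∈ strips f) : g.degree ≤ f.degree :=
  Finsupp.degree_mono (Finset.mem_Icc.1 h).2

theorem antitone_of_mem_strips {f g : ℕ →₀ ℕ} (h : g ∈ strips f) : Antitone g :=
  antitone_nat_of_succ_le fun r => (mem_strips.1 h (r + 1)).2.trans (mem_strips.1 h r).1

theorem self_mem_strips {f : ℕ →₀ ℕ} (h : Antitone f) : f ∈ strips f :=
  mem_strips.2 fun r => ⟨h r.le_succ, le_rfl⟩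

section
variable {R : Type*} [CommSemiring R]

/-- The sum over all ways to remove horizontal strips from `f`, one for each entry of a list of
weights, until nothing is left. -/
noncomputable def stripSum : List R → (ℕ →₀ ℕ) → R
  | [], f => if f = 0 then 1 else 0
  | x :: xs, f => ∑ g ∈ strips f, x ^ (f.degree - g.degree) * stripSum xs g

theorem stripSum_nil (f : ℕ →₀ ℕ) : stripSum ([] : List R) f = if f = 0 then 1 else 0 :=
  rfl

theorem stripSum_cons (x : R) (xs : List R) (f : ℕ →₀ ℕ) :
    stripSum (x :: xs) f = ∑ g ∈ strips f, x ^ (f.degree - g.degree) * stripSum xs g :=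
  rfl

/-- A horizontal strip lowers the number of nonempty rows by at most one, so n strips cannot exhaust
more than n rows. -/
theorem stripSum_eq_zero {xs : List R} {f : ℕ →₀ ℕ} (h : f xs.length ≠ 0) :
    stripSum xs f = 0 := by
  induction xs generalizing f with
  | nil =>
    rw [stripSum_nil, if_neg]
    rintro rfl
    exact h rfl
  | cons x xs ih =>
    refine Finset.sum_eq_zero fun g hg => ?_
    have := (mem_strips.1 hg xs.length).1
    simp only [List.length_cons] at h
    rw [ih (by omega), mul_zero]

/-- The Bender–Knuth involution on the middle terms of the chains `h ⊆ g ⊆ f` of two horizontal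
strips. -/
noncomputable def benderKnuth (f h g : ℕ →₀ ℕ) : ℕ →₀ ℕ :=
  (f.dropHead ⊔ h) + Finsupp.addHead (f 0) (f.dropHead ⊓ h) - g

theorem benderKnuth_zero (f h g : ℕ →₀ ℕ) :
    benderKnuth f h g 0 = max (f 1) (h 0) + f 0 - g 0 := by
  simp [benderKnuth]

theorem benderKnuth_succ (f h g : ℕ →₀ ℕ) (r : ℕ) :
    benderKnuth f h g (r + 1) =
      max (f (r + 2)) (h (r + 1)) + min (f (r + 1)) (h r) - g (r + 1) := by
  simp [benderKnuth]

/-- For fixed f and h, the rows of g vary independently: g r ranges over the interval from max (f (r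
+ 1)) (h r) to min (f r) (h (r - 1)), with upper end f 0 for r = 0. The map reflects each of these
intervals. -/
theorem benderKnuth_mem {f h g : ℕ →₀ ℕ} (hg : g ∈ strips f) (hh : h ∈ strips g) :
    benderKnuth f h g ∈ strips f ∧ h ∈ strips (benderKnuth f h g) := by
  simp only [mem_strips] at *
  have key : ∀ r, f (r + 1) ≤ benderKnuth f h g r ∧ benderKnuth f h g r ≤ f r ∧
      h r ≤ benderKnuth f h g r ∧ benderKnuth f h g (r + 1) ≤ h r := by
    intro r
    have h1 := hg r
    have h2 := hh r
    have h3 := hg (r + 1)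
    have h4 := hh (r + 1)
    have h5 := benderKnuth_succ f h g r
    rcases r with _ | r
    · have h6 := benderKnuth_zero f h g
      simp only [zero_add, Nat.reduceAdd] at *
      omega
    · have h6 := benderKnuth_succ f h g r
      have h7 := hh r
      have h8 := hg r
      simp only [add_assoc, Nat.reduceAdd] at *
      omega
  exact ⟨fun r => ⟨(key r).1, (key r).2.1⟩, fun r => ⟨(key r).2.2.2, (key r).2.2.1⟩⟩

theorem add_benderKnuth {f h g : ℕ →₀ ℕ} (hg : g ∈ strips f) (hh : h ∈ strips g) :
    g + benderKnuth f h g = (f.dropHead ⊔ h) + Finsupp.addHead (f 0) (f.dropHead ⊓ h) := by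
  simp only [mem_strips] at *
  ext r
  rw [Finsupp.add_apply]
  have h1 := hg r
  have h2 := hh r
  rcases r with _ | r
  · rw [benderKnuth_zero]
    simp at *
    omega
  · rw [benderKnuth_succ]
    have h3 := hg r
    have h4 := hh r
    simp [add_assoc] at *
    omega

/-- The interval endpoints add up to |f| + |h|, since max and min of f (r + 1) and h r sum to f (r +
1) + h r. Hence the sizes of the two strips are exchanged. -/
theorem degree_add_degree_benderKnuth {f h g : ℕ →₀ ℕ} (hg : g ∈ strips f) (hh : h ∈ strips g) :
    g.degree + (benderKnuth f h g).degree = f.degree + h.degree := by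
  have h1 := congrArg Finsupp.degree (add_benderKnuth hg hh)
  have h2 := Finsupp.degree_sup_add_degree_inf f.dropHead h
  have h3 := congrArg Finsupp.degree (Finsupp.addHead_dropHead f)
  rw [Finsupp.degree_addHead] at h3
  rw [map_add, map_add, Finsupp.degree_addHead] at h1
  omega

theorem benderKnuth_benderKnuth {f h g : ℕ →₀ ℕ} (hg : g ∈ strips f) (hh : h ∈ strips g) :
    benderKnuth f h (benderKnuth f h g) = g := by
  conv_lhs => rw [benderKnuth, ← add_benderKnuth hg hh]
  exact add_tsub_cancel_right _ _

theorem stripSum_swap (x y : R) (xs : List R) (f : ℕ →₀ ℕ) :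
    stripSum (y :: x :: xs) f = stripSum (x :: y :: xs) f := by
  simp only [stripSum_cons, Finset.mul_sum]
  rw [Finset.sum_sigma', Finset.sum_sigma']
  refine Finset.sum_bij' (fun p _ => ⟨benderKnuth f p.2 p.1, p.2⟩)
    (fun p _ => ⟨benderKnuth f p.2 p.1, p.2⟩) ?_ ?_ ?_ ?_ ?_
  · rintro ⟨g, h⟩ hp
    rw [Finset.mem_sigma] at hp ⊢
    exact benderKnuth_mem hp.1 hp.2
  · rintro ⟨g, h⟩ hp
    rw [Finset.mem_sigma] at hp ⊢
    exact benderKnuth_mem hp.1 hp.2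
  · rintro ⟨g, h⟩ hp
    rw [Finset.mem_sigma] at hp
    simp only [benderKnuth_benderKnuth hp.1 hp.2]
  · rintro ⟨g, h⟩ hp
    rw [Finset.mem_sigma] at hp
    simp only [benderKnuth_benderKnuth hp.1 hp.2]
  · rintro ⟨g, h⟩ hp
    rw [Finset.mem_sigma] at hp
    simp only at hp ⊢
    have h1 := degree_add_degree_benderKnuth hp.1 hp.2
    have h2 := degree_le_of_mem_strips hp.1
    have h3 := degree_le_of_mem_strips hp.2
    rw [show f.degree - (benderKnuth f h g).degree = g.degree - h.degree by omega,
      show (benderKnuth f h g).degree - h.degree = f.degree - g.degree by omega]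
    ring

theorem stripSum_perm {xs ys : List R} (h : xs.Perm ys) (f : ℕ →₀ ℕ) :
    stripSum xs f = stripSum ys f := by
  induction h generalizing f with
  | nil => rfl
  | cons x _ ih => simp only [stripSum_cons, ih]
  | swap x y l => exact stripSum_swap x y l f
  | trans _ _ ih1 ih2 => rw [ih1, ih2]

theorem map_stripSum {S : Type*} [CommSemiring S] (φ : R →+* S) (xs : List R) (f : ℕ →₀ ℕ) :
    φ (stripSum xs f) = stripSum (xs.map φ) f := by
  induction xs generalizing f with
  | nil =>
    rw [List.map_nil, stripSum_nil, stripSum_nil]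
    split_ifs <;> simp
  | cons x xs ih => simp only [List.map_cons, stripSum_cons, map_sum, map_mul, map_pow, ih]

/-- A strip of weight zero contributes only when it is empty. -/
theorem stripSum_zero_cons (xs : List R) {f : ℕ →₀ ℕ} (hf : Antitone f) :
    stripSum (0 :: xs) f = stripSum xs f := by
  rw [stripSum_cons, Finset.sum_eq_single_of_mem f (self_mem_strips hf)]
  · simp
  · intro g hg hne
    have h1 := (Finset.mem_Icc.1 hg).2
    have h2 : g.degree < f.degree := by
      have h3 := congrArg Finsupp.degree (tsub_add_cancel_of_le h1)
      rw [map_add] at h3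
      have h4 : (f - g).degree ≠ 0 := by
        rw [Ne, Finsupp.degree_eq_zero_iff, tsub_eq_zero_iff_le]
        exact fun h5 => hne (le_antisymm h1 h5)
      omega
    rw [zero_pow (by omega), zero_mul]

end

theorem sub_single_one_apply (f : ℕ →₀ ℕ) (r x : ℕ) :
    (f - Finsupp.single r 1 : ℕ →₀ ℕ) x = if x = r then f r - 1 else f x := by
  rw [Finsupp.tsub_apply]
  split_ifs with h
  · rw [h, Finsupp.single_eq_same]
  · rw [Finsupp.single_eq_of_ne h, Nat.sub_zero]

/-! ### Grassmannian permutations: left descents are corners. -/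

/-- `w` is the grassmannian permutation of the partition with parts `f 0, f 1, …`, at most `k` of
them nonzero. -/
structure IsGrassmannian (k : ℕ) (f : ℕ →₀ ℕ) (w : Equiv.Perm ℕ) : Prop where
  antitone : Antitone f
  apply_of_le : ∀ r, k ≤ r → f r = 0
  apply_eq : ∀ i < k, w i = i + f (k - 1 - i)
  strictMonoOn : StrictMonoOn w (Set.Ici k)

namespace IsGrassmannian

variable {k : ℕ} {f : ℕ →₀ ℕ} {w : Equiv.Perm ℕ}

theorem eq_one (h : IsGrassmannian k 0 w) : w = 1 := by
  have hlt : ∀ i < k, w i = i := fun i hi => by simpa using h.apply_eq i hi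
  have hge : ∀ i, k ≤ i → k ≤ w i := fun i hi => by
    by_contra hc
    have := w.injective (hlt (w i) (by omega))
    omega
  have hmono : StrictMono w := by
    intro i j hij
    rcases Nat.lt_or_ge j k with hj | hj
    · rwa [hlt i (by omega), hlt j hj]
    · rcases Nat.lt_or_ge i k with hi | hi
      · rw [hlt i hi]
        exact hi.trans_le (hge j hj)
      · exact h.strictMonoOn hi hj hij
  ext i
  exact congrArg (fun e : ℕ ≃o ℕ => e i) (Subsingleton.elim
    (StrictMono.orderIsoOfSurjective w hmono w.surjective) (OrderIso.refl ℕ))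

theorem ne_one (h : IsGrassmannian k f w) (hf : f ≠ 0) : w ≠ 1 := by
  rintro rfl
  refine hf (Finsupp.ext fun r => ?_)
  rcases Nat.lt_or_ge r k with hr | hr
  · have := h.apply_eq (k - 1 - r) (by omega)
    rw [show k - 1 - (k - 1 - r) = r by omega] at this
    simpa using this
  · exact h.apply_of_le r hr

theorem strictMonoOn_Iio (h : IsGrassmannian k f w) : StrictMonoOn w (Set.Iio k) := by
  intro i hi j hj hij
  rw [h.apply_eq i hi, h.apply_eq j hj]
  have := h.antitone (show k - 1 - j ≤ k - 1 - i by omega)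
  omega

/-- As w increases on both blocks of positions, m + 1 lies in the first block and m in the second.
Row r is the one at the position of m + 1; the equation says that its last cell has content m + 1 -
k, and this cell is a corner because the preceding position does not hold m. -/
theorem exists_row_of_leftDescent (h : IsGrassmannian k f w) {m : ℕ} (hd : LeftDescent w m) :
    ∃ r < k, f r + k = m + r + 2 ∧ f (r + 1) < f r := by
  have hp : w.symm (m + 1) < k := by
    by_contra hc
    have hlt : w.symm (m + 1) < w.symm m := hd
    have := h.strictMonoOn (show k ≤ _ by omega) (show k ≤ w.symm m by omega) hd
    simp at this
  have hq : k ≤ w.symm m := by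
    by_contra hc
    have := h.strictMonoOn_Iio hp (show _ < k by omega) hd
    simp at this
  have hw := h.apply_eq _ hp
  rw [Equiv.apply_symm_apply] at hw
  refine ⟨k - 1 - w.symm (m + 1), by omega, by omega, ?_⟩
  by_contra hc
  have hr := h.antitone (Nat.le_succ (k - 1 - w.symm (m + 1)))
  rcases Nat.eq_zero_or_pos (w.symm (m + 1)) with h0 | h0
  · have := h.apply_of_le (k - 1 - w.symm (m + 1) + 1) (by omega)
    omega
  · have := h.apply_eq (w.symm (m + 1) - 1) (by omega)
    rw [show k - 1 - (w.symm (m + 1) - 1) = k - 1 - w.symm (m + 1) + 1 by omega] at this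
    simp only [Nat.succ_eq_add_one] at hr
    have h2 : w (w.symm (m + 1) - 1) = m := by omega
    rw [← Equiv.eq_symm_apply] at h2
    omega

theorem leftDescent (h : IsGrassmannian k f w) {m r : ℕ} (hr : r < k) (hm : f r + k = m + r + 2)
    (hf : f (r + 1) < f r) : LeftDescent w m := by
  have hp : w.symm (m + 1) = k - 1 - r := by
    rw [Equiv.symm_apply_eq, h.apply_eq _ (by omega), show k - 1 - (k - 1 - r) = r by omega]
    omega
  rw [LeftDescent, hp]
  by_contra hc
  have hw := h.apply_eq (w.symm m) (by omega)
  rw [Equiv.apply_symm_apply] at hw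
  have hne : w.symm m ≠ k - 1 - r := fun he => by
    rw [← hp] at he
    have := w.symm.injective he
    omega
  have := h.antitone (show r + 1 ≤ k - 1 - w.symm m by omega)
  omega

/-- The left multiplication of a grassmannian permutation by a simple transposition that decreases
the length removes a corner. -/
theorem swap_mul (h : IsGrassmannian k f w) {m r : ℕ} (hr : r < k) (hm : f r + k = m + r + 2)
    (hf : f (r + 1) < f r) :
    IsGrassmannian k (f - Finsupp.single r 1) (Equiv.swap m (m + 1) * w) := by
  have hd := h.leftDescent hr hm hf
  have hs := sub_single_one_apply f r
  refine ⟨?_, ?_, ?_, h.strictMonoOn.swap_mul hd⟩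
  · refine antitone_nat_of_succ_le fun x => ?_
    have := h.antitone x.le_succ
    rw [hs, hs]
    split_ifs with h1 h2 h2 <;> subst_vars <;> simp only [Nat.succ_eq_add_one] at * <;> omega
  · intro x hx
    rw [hs, if_neg (by omega), h.apply_of_le x hx]
  · intro i hi
    have hp : w (k - 1 - r) = m + 1 := by
      rw [h.apply_eq _ (by omega), show k - 1 - (k - 1 - r) = r by omega]
      omega
    rw [Equiv.Perm.mul_apply, hs]
    split_ifs with hir
    · rw [show i = k - 1 - r by omega, hp, Equiv.swap_apply_right]
      omega
    · rw [← h.apply_eq i hi]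
      refine Equiv.swap_apply_of_ne_of_ne (fun hc => ?_) (fun hc => ?_)
      · have h1 : w.symm m = i := by rw [← hc]; simp
        have h2 : w.symm (m + 1) = k - 1 - r := by rw [← hp]; simp
        have h3 : LeftDescent w m := hd
        rw [LeftDescent, h1, h2] at h3
        have := h.antitone (show k - 1 - i + 1 ≤ r by omega)
        have h4 := h.antitone (show k - 1 - i ≤ r by omega)
        have h5 := h.apply_eq i hi
        omega
      · have := w.injective (hc.trans hp.symm)
        omega

end IsGrassmannian

/-! ### Grassmannian Schubert polynomials as strip sums. -/

open scoped Classical in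
/-- The members `g` of `strips f` such that `f / g` has no cell of content at least `m + 1 - k`. -/
noncomputable def stripsBelow (k m : ℕ) (f : ℕ →₀ ℕ) : Finset (ℕ →₀ ℕ) :=
  (strips f).filter fun g => ∀ r, g r = f r ∨ f r + k ≤ m + r + 1

theorem mem_stripsBelow {k m : ℕ} {f g : ℕ →₀ ℕ} : g ∈ stripsBelow k m f ↔
    (∀ r, f (r + 1) ≤ g r ∧ g r ≤ f r) ∧ ∀ r, g r = f r ∨ f r + k ≤ m + r + 1 := by
  classical
  rw [stripsBelow, Finset.mem_filter, mem_strips]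

theorem stripsBelow_succ_of_forall_not {k m : ℕ} {f : ℕ →₀ ℕ}
    (h : ∀ r, f r + k = m + r + 2 → f r ≤ f (r + 1)) :
    stripsBelow k (m + 1) f = stripsBelow k m f := by
  ext g
  rw [mem_stripsBelow, mem_stripsBelow]
  refine and_congr_right fun h1 => forall_congr' fun r => ?_
  have := h r
  have := h1 r
  omega

/-- The corner of row r is the only row end of content m + 1 - k, because f x - x strictly
decreases. Either g keeps it, or it is removed first and the remaining strip has smaller contents.
-/
theorem stripsBelow_succ {k m r : ℕ} {f : ℕ →₀ ℕ} (h : Antitone f) (hm : f r + k = m + r + 2)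
    (hf : f (r + 1) < f r) :
    stripsBelow k (m + 1) f = stripsBelow k m f ∪ stripsBelow k m (f - Finsupp.single r 1) := by
  have hs := sub_single_one_apply f r
  have hlt : ∀ x, x < r → f r ≤ f x := fun x hx => h hx.le
  have hgt : ∀ x, r < x → f x ≤ f r := fun x hx => h hx.le
  ext g
  simp only [Finset.mem_union, mem_stripsBelow, hs]
  constructor
  · rintro ⟨h1, h2⟩
    by_cases hg : g r = f r
    · left
      refine ⟨h1, fun x => ?_⟩
      rcases lt_trichotomy x r with hx | rfl | hx
      · have := h2 x; have := hlt x hx; omega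
      · exact Or.inl hg
      · have := h2 x; have := hgt x hx; omega
    · right
      refine ⟨fun x => ?_, fun x => ?_⟩
      · have := h1 x
        have := h1 r
        split_ifs with hx1 hx2 hx2 <;> subst_vars <;> omega
      · have := h2 x
        rcases lt_trichotomy x r with hx | rfl | hx
        · rw [if_neg hx.ne]; have := hlt x hx; omega
        · rw [if_pos rfl]; omega
        · rw [if_neg hx.ne']; have := hgt x hx; omega
  · rintro (⟨h1, h2⟩ | ⟨h1, h2⟩)
    · exact ⟨h1, fun x => by have := h2 x; omega⟩
    · refine ⟨fun x => ?_, fun x => ?_⟩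
      · have h3 := h1 x
        have h4 := h2 x
        rcases lt_trichotomy x r with hx | rfl | hx
        -- Rows above r end at larger content, so they are untouched. This restores the bound f r ≤
        -- g (r - 1), which the smaller partition gives only with f r - 1.
        · have := hlt x hx
          rw [if_neg hx.ne] at h3 h4
          refine ⟨?_, h3.2⟩
          have := h (show x ≤ x + 1 by omega)
          omega
        · rw [if_neg (by omega), if_pos rfl] at h3
          omega
        · rwa [if_neg (by omega), if_neg hx.ne'] at h3
      · have h4 := h2 x
        split_ifs at h4 with hx
        · subst hx; omega
        · omega

theorem disjoint_stripsBelow {k m r : ℕ} {f : ℕ →₀ ℕ} (hm : f r + k = m + r + 2)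
    (hf : 0 < f r) :
    Disjoint (stripsBelow k m f) (stripsBelow k m (f - Finsupp.single r 1)) := by
  rw [Finset.disjoint_left]
  intro g h1 h2
  have h3 := (mem_stripsBelow.1 h1).2 r
  have h4 := ((mem_stripsBelow.1 h2).1 r).2
  rw [Finsupp.tsub_apply, Finsupp.single_eq_same] at h4
  omega

theorem degree_le_of_mem_stripsBelow {k m : ℕ} {f g : ℕ →₀ ℕ} (h : g ∈ stripsBelow k m f) :
    g.degree ≤ f.degree := by
  classical
  exact degree_le_of_mem_strips (Finset.mem_filter.1 h).1

/-- The inner recursion for a fixed variable: raising m admits the next content, so the letters with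
value i build up one horizontal strip, by increasing content. -/
theorem IsGrassmannian.schubertFrom_eq_sum {k i M : ℕ} {xs : List (MvPolynomial ℕ ℤ)}
    (hxs : xs.length + i + 1 = k)
    (hrec : ∀ f w, IsGrassmannian k f w → (∀ x, M < x → w x = x) →
      schubertFrom i i w = stripSum xs f)
    {m : ℕ} (him : i ≤ m) (hmM : m ≤ M) {f : ℕ →₀ ℕ} {w : Equiv.Perm ℕ} (h : IsGrassmannian k f w)
    (hM : ∀ x, M < x → w x = x) :
    schubertFrom i m w =
      ∑ g ∈ stripsBelow k m f, X i ^ (f.degree - g.degree) * stripSum xs g := by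
  induction m, him using Nat.le_induction generalizing f w with
  | base =>
    rw [hrec f w h hM, Finset.sum_eq_single f]
    · simp
    · intro g hg hne
      rw [mem_stripsBelow] at hg
      have : ∃ r, g r ≠ f r := by
        by_contra hc
        push Not at hc
        exact hne (Finsupp.ext hc)
      obtain ⟨r, hr⟩ := this
      have h1 := hg.1 r
      have h2 := hg.2 r
      -- A shortened row r has content bound f r + xs.length ≤ r with f r > 0, so r > xs.length.
      -- Then g has more than xs.length nonempty rows, too many for the remaining variables.
      rw [stripSum_eq_zero, mul_zero]
      have h3 := h.antitone (show xs.length + 1 ≤ r by omega)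
      have h4 := (hg.1 xs.length).1
      omega
    · intro hf
      refine absurd (mem_stripsBelow.2 ⟨fun r => ⟨h.antitone r.le_succ, le_rfl⟩,
        fun r => Or.inl rfl⟩) hf
  | succ m him ih =>
    by_cases hd : LeftDescent w m
    · obtain ⟨r, hr, hm, hf⟩ := h.exists_row_of_leftDescent hd
      have hdeg : f.degree = (f - Finsupp.single r 1).degree + 1 := by
        conv_lhs => rw [← tsub_add_cancel_of_le
          (show Finsupp.single r 1 ≤ f by rw [Finsupp.single_le_iff]; omega)]
        rw [map_add, Finsupp.degree_single]
      rw [schubertFrom_succ_of_leftDescent hd him, stripsBelow_succ h.antitone hm hf,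
        Finset.sum_union (disjoint_stripsBelow hm (by omega)), ih (by omega) h hM,
        ih (by omega) (h.swap_mul hr hm hf) (swap_mul_apply_of_lt hM (by omega)), Finset.mul_sum]
      congr 1
      refine Finset.sum_congr rfl fun g hg => ?_
      have := degree_le_of_mem_stripsBelow hg
      rw [hdeg, Nat.sub_add_comm this, pow_succ']
      ring
    · rw [schubertFrom_succ_of_not_leftDescent hd, ih (by omega) h hM,
        stripsBelow_succ_of_forall_not]
      intro r hr
      by_contra hc
      refine hd (h.leftDescent ?_ hr (by omega))
      by_contra hrk
      have := h.apply_of_le r (by omega)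
      omega

/-- A row end of content at least M + 1 - k would give a value of w above M in one of the first k
positions, but such values are fixed and a nonempty row moves its position. -/
theorem IsGrassmannian.stripsBelow_eq {k M : ℕ} {f : ℕ →₀ ℕ} {w : Equiv.Perm ℕ}
    (h : IsGrassmannian k f w) (hM : ∀ x, M < x → w x = x) : stripsBelow k M f = strips f := by
  classical
  refine Finset.filter_true_of_mem fun g hg r => ?_
  rcases Nat.eq_zero_or_pos (f r) with h0 | h0
  · left
    have := (mem_strips.1 hg r).2
    omega
  · right
    have hr : r < k := by
      by_contra hr
      have := h.apply_of_le r (by omega)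
      omega
    have h1 := h.apply_eq (k - 1 - r) (by omega)
    rw [show k - 1 - (k - 1 - r) = r by omega] at h1
    by_contra hc
    have h2 := w.injective (hM (w (k - 1 - r)) (by omega))
    omega

theorem IsGrassmannian.schubertFrom_eq_stripSum {k i M : ℕ} (hi : i ≤ k) (hk : k ≤ M)
    {f : ℕ →₀ ℕ} {w : Equiv.Perm ℕ} (h : IsGrassmannian k f w) (hM : ∀ x, M < x → w x = x) :
    schubertFrom i M w = stripSum ((List.range' i (k - i)).map X) f := by
  induction hi using Nat.decreasingInduction generalizing f w with
  | self =>
    rw [Nat.sub_self, List.range'_zero, List.map_nil, stripSum_nil]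
    split_ifs with hf
    · subst hf
      rw [h.eq_one, schubertFrom_one]
    · exact schubertFrom_eq_zero hk le_rfl le_rfl h.strictMonoOn hM (h.ne_one hf)
  | of_succ i hi ih =>
    rw [show k - i = k - (i + 1) + 1 by omega, List.range'_succ, List.map_cons, stripSum_cons,
      ← h.stripsBelow_eq hM]
    refine h.schubertFrom_eq_sum (by simp; omega) (fun f w h hM => ?_) (by omega) le_rfl hM
    rw [schubertFrom_self hM, ih h hM]

/-- The Schubert polynomial of a grassmannian permutation as a sum over chains of horizontal
strips. -/
theorem IsGrassmannian.schubert_eq_stripSum {k M : ℕ} {f : ℕ →₀ ℕ} {w : Equiv.Perm ℕ}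
    (h : IsGrassmannian k f w) (hM : ∀ x, M < x → w x = x) :
    schubert w = stripSum ((List.range k).map X) f := by
  have hM' : ∀ x, max k M < x → w x = x := fun x hx => hM x (by omega)
  rw [schubert_eq_schubertFrom hM', h.schubertFrom_eq_stripSum (Nat.zero_le k) (by omega) hM',
    List.range_eq_range', Nat.sub_zero]

/-! ### Semistandard tableaux as chains of horizontal strips. -/

/-- The sequence of the row lengths of a Young diagram. -/
noncomputable def YoungDiagram.rowLenFinsupp (μ : YoungDiagram) : ℕ →₀ ℕ :=
  Finsupp.onFinset (Finset.range (μ.colLen 0)) μ.rowLen fun r hr => by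
    rw [Finset.mem_range, ← YoungDiagram.mem_iff_lt_colLen, YoungDiagram.mem_iff_lt_rowLen]
    exact Nat.pos_of_ne_zero hr

@[simp]
theorem YoungDiagram.rowLenFinsupp_apply (μ : YoungDiagram) (r : ℕ) :
    μ.rowLenFinsupp r = μ.rowLen r :=
  rfl

theorem YoungDiagram.antitone_rowLenFinsupp (μ : YoungDiagram) : Antitone μ.rowLenFinsupp :=
  fun _ _ h => μ.rowLen_anti _ _ h

theorem YoungDiagram.degree_rowLenFinsupp (μ : YoungDiagram) :
    μ.rowLenFinsupp.degree = μ.cells.card := by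
  have hmaps : ∀ c ∈ μ.cells, c.1 ∈ Finset.range (μ.colLen 0) := by
    rintro ⟨i, j⟩ hc
    rw [Finset.mem_range, ← YoungDiagram.mem_iff_lt_colLen]
    exact μ.up_left_mem le_rfl (Nat.zero_le j) hc
  rw [Finset.card_eq_sum_card_fiberwise hmaps, Finsupp.degree_apply]
  refine (Finset.sum_subset Finsupp.support_onFinset_subset fun r _ hr => ?_).trans
    (Finset.sum_congr rfl fun r _ => μ.rowLen_eq_card)
  exact Finsupp.notMem_support_iff.1 hr

theorem YoungDiagram.exists_rowLenFinsupp_eq {f : ℕ →₀ ℕ} (hf : Antitone f) :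
    ∃ μ : YoungDiagram, μ.rowLenFinsupp = f := by
  let μ : YoungDiagram :=
    { cells := (f.support ×ˢ Finset.range (f 0)).filter fun c => c.2 < f c.1
      isLowerSet := by
        rintro ⟨i, j⟩ ⟨i', j'⟩ ⟨hi, hj⟩ h
        simp only [Finset.coe_filter, Finset.mem_product, Finsupp.mem_support_iff,
          Finset.mem_range, Set.mem_ofPred_eq] at hi hj h ⊢
        have h1 := hf hi
        have h2 := hf (Nat.zero_le i')
        omega }
  have hμ : ∀ i j, (i, j) ∈ μ ↔ j < f i := by
    intro i j
    have h1 := hf (Nat.zero_le i)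
    rw [← YoungDiagram.mem_cells, Finset.mem_filter, Finset.mem_product,
      Finsupp.mem_support_iff, Finset.mem_range]
    simp only
    omega
  refine ⟨μ, Finsupp.ext fun r => ?_⟩
  refine eq_of_forall_lt_iff fun j => ?_
  rw [YoungDiagram.rowLenFinsupp_apply, ← YoungDiagram.mem_iff_lt_rowLen, hμ]

theorem YoungDiagram.rowLenFinsupp_injective : Function.Injective YoungDiagram.rowLenFinsupp := by
  intro μ ν h
  ext ⟨i, j⟩
  rw [YoungDiagram.mem_cells, YoungDiagram.mem_cells, YoungDiagram.mem_iff_lt_rowLen,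
    YoungDiagram.mem_iff_lt_rowLen, ← YoungDiagram.rowLenFinsupp_apply, h,
    YoungDiagram.rowLenFinsupp_apply]

namespace SemistandardYoungTableau

variable {lam : YoungDiagram}

/-- The Young diagram of the cells of a semistandard tableau with entries less than `k`. -/
def shapeBelow (T : SemistandardYoungTableau lam) (k : ℕ) : YoungDiagram where
  cells := lam.cells.filter fun c => T c.1 c.2 < k
  isLowerSet := by
    rintro ⟨i, j⟩ ⟨i', j'⟩ ⟨hi, hj⟩ h
    simp only [Finset.coe_filter, Set.mem_ofPred_eq, YoungDiagram.mem_cells] at hi hj h ⊢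
    exact ⟨lam.up_left_mem hi hj h.1, ((T.col_weak hi (lam.up_left_mem le_rfl hj h.1)).trans
      (T.row_weak_of_le hj h.1)).trans_lt h.2⟩

theorem mem_shapeBelow {T : SemistandardYoungTableau lam} {k i j : ℕ} :
    (i, j) ∈ T.shapeBelow k ↔ (i, j) ∈ lam ∧ T i j < k := by
  rw [← YoungDiagram.mem_cells, shapeBelow, Finset.mem_filter, YoungDiagram.mem_cells]

/-- Columns increase strictly, so a cell with another cell beneath it cannot hold the maximal entry
k. -/
theorem shapeBelow_mem_strips {T : SemistandardYoungTableau lam} {k : ℕ}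
    (hT : T ∈ boundedTableaux lam (k + 1)) :
    (T.shapeBelow k).rowLenFinsupp ∈ strips lam.rowLenFinsupp := by
  rw [mem_strips]
  intro r
  simp only [YoungDiagram.rowLenFinsupp_apply]
  constructor
  · refine le_of_forall_lt fun j hj => ?_
    rw [← YoungDiagram.mem_iff_lt_rowLen] at hj ⊢
    have h1 := T.col_strict (Nat.lt_succ_self r) hj
    have h2 := hT _ hj
    simp only [Nat.succ_eq_add_one] at h1 h2
    exact mem_shapeBelow.2 ⟨lam.up_left_mem r.le_succ le_rfl hj, by omega⟩
  · refine le_of_forall_lt fun j hj => ?_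
    rw [← YoungDiagram.mem_iff_lt_rowLen] at hj ⊢
    exact (mem_shapeBelow.1 hj).1

/-- The restriction of a semistandard tableau to a smaller shape. -/
def restrict (T : SemistandardYoungTableau lam) {μ : YoungDiagram} (hμ : μ ≤ lam) :
    SemistandardYoungTableau μ where
  entry i j := if (i, j) ∈ μ then T i j else 0
  row_weak' {i j1 j2} hj hc := by
    rw [if_pos hc, if_pos (μ.up_left_mem le_rfl hj.le hc)]
    exact T.row_weak hj (hμ hc)
  col_strict' {i1 i2 j} hi hc := by
    rw [if_pos hc, if_pos (μ.up_left_mem hi.le le_rfl hc)]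
    exact T.col_strict hi (hμ hc)
  zeros' hc := if_neg hc

theorem restrict_apply (T : SemistandardYoungTableau lam) {μ : YoungDiagram} (hμ : μ ≤ lam)
    (i j : ℕ) : T.restrict hμ i j = if (i, j) ∈ μ then T i j else 0 :=
  rfl

/-- The extension of a semistandard tableau of shape `μ` with entries less than `k` by entries `k`
in the cells of a horizontal strip. -/
def extend {μ : YoungDiagram} (T : SemistandardYoungTableau μ) {k : ℕ}
    (hT : T ∈ boundedTableaux μ k) (hμ : μ.rowLenFinsupp ∈ strips lam.rowLenFinsupp) :
    SemistandardYoungTableau lam where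
  entry i j := if (i, j) ∈ μ then T i j else if (i, j) ∈ lam then k else 0
  row_weak' {i j1 j2} hj hc := by
    rw [if_pos hc, if_pos (lam.up_left_mem le_rfl hj.le hc)]
    by_cases h2 : (i, j2) ∈ μ
    · rw [if_pos h2, if_pos (μ.up_left_mem le_rfl hj.le h2)]
      exact T.row_weak hj h2
    · rw [if_neg h2]
      split_ifs with h1
      · exact (hT _ h1).le
      · exact le_rfl
  col_strict' {i1 i2 j} hi hc := by
    have h1 : (i1, j) ∈ μ := by
      rw [YoungDiagram.mem_iff_lt_rowLen] at hc ⊢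
      have h2 := (mem_strips.1 hμ i1).1
      have h3 := lam.rowLen_anti (i1 + 1) i2 hi
      simp only [YoungDiagram.rowLenFinsupp_apply] at h2
      omega
    rw [if_pos hc, if_pos h1]
    split_ifs with h2
    · exact T.col_strict hi h2
    · exact hT _ h1
  zeros' {i j} hc := by
    rw [if_neg hc, if_neg]
    rw [YoungDiagram.mem_iff_lt_rowLen] at hc ⊢
    have := (mem_strips.1 hμ i).2
    simp only [YoungDiagram.rowLenFinsupp_apply] at this
    omega

theorem extend_apply {μ : YoungDiagram} (T : SemistandardYoungTableau μ) {k : ℕ}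
    (hT : T ∈ boundedTableaux μ k) (hμ : μ.rowLenFinsupp ∈ strips lam.rowLenFinsupp) (i j : ℕ) :
    T.extend hT hμ i j = if (i, j) ∈ μ then T i j else if (i, j) ∈ lam then k else 0 :=
  rfl

end SemistandardYoungTableau

open SemistandardYoungTableau

theorem YoungDiagram.le_of_mem_strips {lam μ : YoungDiagram}
    (h : μ.rowLenFinsupp ∈ strips lam.rowLenFinsupp) : μ ≤ lam := by
  rintro ⟨i, j⟩ hc
  have := (mem_strips.1 h i).2
  simp only [YoungDiagram.rowLenFinsupp_apply] at this
  exact YoungDiagram.mem_iff_lt_rowLen.2 ((YoungDiagram.mem_iff_lt_rowLen.1 hc).trans_le this)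

/-- Deleting the entries k and filling the strip with k are inverse bijections; the strip
contributes one factor X k per cell. -/
theorem sum_shapeBelow_eq {lam μ : YoungDiagram} (k : ℕ)
    (h : μ.rowLenFinsupp ∈ strips lam.rowLenFinsupp) :
    ∑ T ∈ (boundedTableaux_finite lam (k + 1)).toFinset with
        (T.shapeBelow k).rowLenFinsupp = μ.rowLenFinsupp,
      ∏ c ∈ lam.cells, (X (T c.1 c.2) : MvPolynomial ℕ ℤ) =
    X k ^ (lam.rowLenFinsupp.degree - μ.rowLenFinsupp.degree) * schurPoly μ k := by
  have hle := YoungDiagram.le_of_mem_strips h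
  have hS : ∀ T ∈ (boundedTableaux_finite lam (k + 1)).toFinset.filter fun T =>
      (T.shapeBelow k).rowLenFinsupp = μ.rowLenFinsupp,
      T ∈ boundedTableaux lam (k + 1) ∧ T.shapeBelow k = μ := by
    intro T hT
    rw [Finset.mem_filter, Set.Finite.mem_toFinset] at hT
    exact ⟨hT.1, YoungDiagram.rowLenFinsupp_injective hT.2⟩
  rw [schurPoly, Finset.mul_sum]
  refine Finset.sum_bij' (fun T _ => T.restrict hle)
    (fun T hT => T.extend ((boundedTableaux_finite μ k).mem_toFinset.1 hT) h) ?_ ?_ ?_ ?_ ?_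
  · rintro T hT
    obtain ⟨hb, rfl⟩ := hS T hT
    rw [Set.Finite.mem_toFinset]
    rintro ⟨i, j⟩ hc
    rw [YoungDiagram.mem_cells] at hc
    rw [restrict_apply, if_pos hc]
    exact (mem_shapeBelow.1 hc).2
  · rintro T hT
    rw [Set.Finite.mem_toFinset] at hT
    rw [Finset.mem_filter, Set.Finite.mem_toFinset]
    constructor
    · rintro ⟨i, j⟩ hc
      rw [extend_apply]
      split_ifs with h1 h2
      · exact (hT _ h1).trans (Nat.lt_succ_self k)
      · exact Nat.lt_succ_self k
      · exact Nat.succ_pos k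
    · congr 1
      ext ⟨i, j⟩
      rw [YoungDiagram.mem_cells, YoungDiagram.mem_cells, mem_shapeBelow, extend_apply]
      constructor
      · rintro ⟨h1, h2⟩
        by_contra h3
        rw [if_neg h3, if_pos h1] at h2
        omega
      · intro h1
        rw [if_pos h1]
        exact ⟨hle h1, hT _ h1⟩
  · rintro T hT
    obtain ⟨hb, rfl⟩ := hS T hT
    ext i j
    rw [extend_apply, restrict_apply]
    split_ifs with h1 h2
    · rfl
    · rw [mem_shapeBelow] at h1
      have := hb _ h2
      simp only at this
      have : ¬ T i j < k := fun h3 => h1 ⟨h2, h3⟩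
      omega
    · exact (T.zeros h2).symm
  · rintro T hT
    ext i j
    rw [restrict_apply, extend_apply]
    split_ifs with h1
    · rfl
    · exact (T.zeros h1).symm
  · rintro T hT
    obtain ⟨hb, rfl⟩ := hS T hT
    rw [YoungDiagram.degree_rowLenFinsupp, YoungDiagram.degree_rowLenFinsupp,
      ← Finset.card_sdiff_of_subset hle, ← Finset.prod_const, ← Finset.prod_sdiff hle]
    congr 1
    · refine Finset.prod_congr rfl fun c hc => ?_
      obtain ⟨i, j⟩ := c
      rw [Finset.mem_sdiff, YoungDiagram.mem_cells, YoungDiagram.mem_cells, mem_shapeBelow] at hc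
      have h1 := hb _ hc.1
      have h2 : ¬ T i j < k := fun h3 => hc.2 ⟨hc.1, h3⟩
      simp only at h1 h2 ⊢
      rw [show T i j = k by omega]
    · refine Finset.prod_congr rfl fun c hc => ?_
      rw [YoungDiagram.mem_cells] at hc
      rw [restrict_apply, if_pos hc]

theorem schurPoly_zero (lam : YoungDiagram) :
    schurPoly lam 0 = if lam.rowLenFinsupp = 0 then 1 else 0 := by
  have hlam : lam.rowLenFinsupp = 0 ↔ lam.cells = ∅ := by
    rw [← Finsupp.degree_eq_zero_iff, YoungDiagram.degree_rowLenFinsupp, Finset.card_eq_zero]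
  simp only [hlam]
  split_ifs with h
  -- Here `highestWeight` merely names the unique tableau of empty shape.
  · have huniq : (boundedTableaux_finite lam 0).toFinset = {highestWeight lam} := by
      ext T
      rw [Set.Finite.mem_toFinset, Finset.mem_singleton]
      constructor
      · intro _
        ext i j
        have hc : (i, j) ∉ lam := by rw [← YoungDiagram.mem_cells, h]; simp
        rw [T.zeros hc, zeros _ hc]
      · rintro rfl c hc
        rw [h] at hc
        simp at hc
    rw [schurPoly, huniq, Finset.sum_singleton, h, Finset.prod_empty]
  · refine Finset.sum_eq_zero fun T hT => ?_
    obtain ⟨c, hc⟩ := Finset.nonempty_iff_ne_empty.2 h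
    rw [Set.Finite.mem_toFinset] at hT
    exact absurd (hT c hc) (Nat.not_lt_zero _)

/-- The Schur polynomial as a sum over chains of horizontal strips. -/
theorem schurPoly_eq_stripSum (lam : YoungDiagram) (k : ℕ) :
    schurPoly lam k = stripSum ((List.range k).map X).reverse lam.rowLenFinsupp := by
  induction k generalizing lam with
  | zero => exact schurPoly_zero lam
  | succ k ih =>
    rw [List.range_succ, List.map_append, List.reverse_append, List.map_singleton,
      List.reverse_singleton, List.singleton_append, stripSum_cons, schurPoly,
      ← Finset.sum_fiberwise_of_maps_to (g := fun T => (T.shapeBelow k).rowLenFinsupp)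
        fun T hT => shapeBelow_mem_strips ((Set.Finite.mem_toFinset _).1 hT)]
    refine Finset.sum_congr rfl fun g hg => ?_
    obtain ⟨μ, rfl⟩ := YoungDiagram.exists_rowLenFinsupp_eq (antitone_of_mem_strips hg)
    rw [sum_shapeBelow_eq k hg, ih]

/-! ### Truncation of Schur polynomials and the conclusion. -/

theorem truncate_stripSum {k n : ℕ} {f : ℕ →₀ ℕ} (hf : Antitone f) (hkn : k ≤ n) :
    truncate k (stripSum ((List.range n).map X).reverse f) =
      stripSum ((List.range k).map X).reverse f := by
  induction n, hkn using Nat.le_induction with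
  | base =>
    have h := map_stripSum (truncate k : MvPolynomial ℕ ℤ →+* MvPolynomial ℕ ℤ)
      ((List.range k).map X).reverse f
    refine h.trans ?_
    rw [List.map_reverse, List.map_map]
    congr 2
    refine List.map_congr_left fun i hi => ?_
    simp [truncate, List.mem_range.1 hi]
  | succ n hkn ih =>
    rw [← ih]
    have h := map_stripSum (truncate k : MvPolynomial ℕ ℤ →+* MvPolynomial ℕ ℤ)
    refine (h _ f).trans (Eq.trans ?_ (h _ f).symm)
    rw [List.range_succ, List.map_append, List.reverse_append, List.map_singleton,
      List.reverse_singleton, List.singleton_append, List.map_cons]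
    have : (truncate k : MvPolynomial ℕ ℤ →+* MvPolynomial ℕ ℤ) (X n) = 0 := by
      simp [truncate, hkn]
    rw [this, stripSum_zero_cons _ hf]

theorem isGrassmannian_grassmannianPerm (lam : YoungDiagram) {k : ℕ} (h : lam.colLen 0 ≤ k) :
    IsGrassmannian k lam.rowLenFinsupp (grassmannianPerm lam k h) where
  antitone := lam.antitone_rowLenFinsupp
  apply_of_le r hr := by
    by_contra hc
    have := YoungDiagram.mem_iff_lt_colLen.1
      (YoungDiagram.mem_iff_lt_rowLen.2 (Nat.pos_of_ne_zero hc))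
    omega
  apply_eq i hi := if_pos hi
  strictMonoOn _ hi _ _ hij := grassmannianFun_lt lam h hij (Or.inr hi)

theorem grassmannianPerm_apply_of_le (lam : YoungDiagram) {k : ℕ} (h : lam.colLen 0 ≤ k) {x : ℕ}
    (hx : k + lam.rowLen 0 ≤ x) : grassmannianPerm lam k h x = x := by
  change grassmannianFun lam k x = x
  have : lam.colLen (x - k) = 0 := by
    by_contra h0
    have := YoungDiagram.mem_iff_lt_rowLen.1
      (YoungDiagram.mem_iff_lt_colLen.2 (Nat.pos_of_ne_zero h0))
    omega
  rw [grassmannianFun, if_neg (by omega), this, Nat.sub_zero]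

/-- Prepending l fixed points only adds l empty rows to the partition. -/
theorem IsGrassmannian.crossPerm_one {k : ℕ} {f : ℕ →₀ ℕ} {v : Equiv.Perm ℕ}
    (h : IsGrassmannian k f v) (l : ℕ) :
    IsGrassmannian (k + l) f (crossPerm l 1 v fun _ _ => rfl) where
  antitone := h.antitone
  apply_of_le r hr := h.apply_of_le r (by omega)
  apply_eq i hi := by
    change (if i < l then i else l + v (i - l)) = _
    split_ifs with hil
    · rw [h.apply_of_le _ (by omega), add_zero]
    · rw [h.apply_eq _ (by omega), show k - 1 - (i - l) = k + l - 1 - i by omega]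
      omega
  strictMonoOn i hi j hj hij := by
    change (if i < l then i else l + v (i - l)) < (if j < l then j else l + v (j - l))
    simp only [Set.mem_Ici] at hi hj
    rw [if_neg (by omega), if_neg (by omega)]
    have := h.strictMonoOn (show k ≤ i - l by omega) (show k ≤ j - l by omega)
      (show i - l < j - l by omega)
    omega

theorem crossPerm_eq_mul {l : ℕ} {u : Equiv.Perm ℕ} (v : Equiv.Perm ℕ)
    (hu : ∀ i, l ≤ i → u i = i) :
    crossPerm l u v hu = u * crossPerm l 1 v fun _ _ => rfl := by
  ext i
  change (if i < l then u i else l + v (i - l)) = u (if i < l then i else l + v (i - l))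
  split_ifs
  · rfl
  · rw [hu _ (by omega)]

theorem IsGrassmannian.schubert_eq_schurPoly {lam : YoungDiagram} {k M : ℕ} {w : Equiv.Perm ℕ}
    (h : IsGrassmannian k lam.rowLenFinsupp w) (hM : ∀ x, M < x → w x = x) :
    schubert w = schurPoly lam k := by
  rw [h.schubert_eq_stripSum hM, schurPoly_eq_stripSum]
  -- The two strip sums use the variables in opposite orders; Bender–Knuth symmetry identifies them.
  exact stripSum_perm (List.reverse_perm _).symm _

theorem truncate_schurPoly (lam : YoungDiagram) {k n : ℕ} (hkn : k ≤ n) :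
    truncate k (schurPoly lam n) = schurPoly lam k := by
  rw [schurPoly_eq_stripSum, schurPoly_eq_stripSum,
    truncate_stripSum lam.antitone_rowLenFinsupp hkn]

theorem mainTheorem4 (lam : YoungDiagram) (k : ℕ) (hlam : lam.colLen 0 ≤ k)
    (u : Equiv.Perm ℕ) (hdesc : ∀ i, k ≤ i → u i < u (i + 1))
    (l : ℕ) (hkl : k ≤ l) (hu : ∀ i, l ≤ i → u i = i) :
    schubert u * schubert (grassmannianPerm lam k hlam) = schubert u * schurPoly lam k ∧
      schubert u * schurPoly lam k =
        truncate k (schubert (crossPerm l u (grassmannianPerm lam k hlam) hu)) := by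
  have hv := isGrassmannian_grassmannianPerm lam hlam
  have hvM : ∀ x, k + lam.rowLen 0 ≤ x → grassmannianPerm lam k hlam x = x :=
    fun x hx => grassmannianPerm_apply_of_le lam hlam hx
  have hcM : ∀ x, l + (k + lam.rowLen 0) < x →
      crossPerm l 1 (grassmannianPerm lam k hlam) (fun _ _ => rfl) x = x := by
    intro x hx
    change (if x < l then x else l + grassmannianPerm lam k hlam (x - l)) = x
    rw [if_neg (by omega), hvM _ (by omega)]
    omega
  have huM : ∀ x, l + (k + lam.rowLen 0) < x → u x = x := fun x hx => hu x (by omega)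
  have humono : StrictMonoOn u (Set.Ici k) := by
    intro i hi j _ hij
    have hmono : StrictMono fun n => u (k + n) := strictMono_nat_of_lt_succ fun n =>
      hdesc (k + n) (by omega)
    simp only [Set.mem_Ici] at hi
    have := hmono (show i - k < j - k by omega)
    simpa [show k + (i - k) = i by omega, show k + (j - k) = j by omega] using this
  constructor
  · rw [hv.schubert_eq_schurPoly fun x hx => hvM x hx.le]
  · rw [crossPerm_eq_mul, schubert_mul hu (fun x hx => if_pos hx) huM hcM, map_mul,
      truncate_schubert humono huM, (hv.crossPerm_one l).schubert_eq_schurPoly hcM,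
      truncate_schurPoly lam (by omega)]
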